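/- **Setting.** Let $0<\lambda_{\max}<\infty$ and let $\psi:[0,\lambda_{\max})\to\mathbb{R}_{\ge 0}$ be CGF-like, i.e. strictly convex and twice continuously differentiable with $\psi(0)=\lim_{\lambda\to0^+}\psi'(\lambda)=0$. Put $\psi(\lambda_{\max})=\lim_{\lambda\uparrow\lambda_{\max}}\psi(\lambda)\in(0,\infty]$, let $\psi^*(u)=\sup_{\lambda\in[0,\lambda_{\max})}(\lambda u-\psi(\lambda))$ be the convex conjugate, and let $(\psi^*)^{-1}$ be the inverse of the bijection $\psi^*:[0,\infty)\to[0,\infty)$. Write $\gamma_{\min}$ for the smallest eigenvalue of a symmetric matrix, $\|v\|_A=\sqrt{\langle v,Av\rangle}$, and $A\succeq B$ if $A-B$ is positive semidefinite. On a probability space with a filtration $(\mathcal F_t)_{t=0,1,2,\dots}$, let $(S_t)$ and $(V_t)$ be adapted processes, with $S_t\in\mathbb{R}^d$, $d\ge1$, and $V_t\in\mathbb{R}^{d\times d}$ symmetric positive definite. $(S_t,V_t)$ is a sub-$\psi$ process if for every $\theta\in\mathbb{R}^d$ with $\|\theta\|_2=1$ and every $\lambda\in[0,\lambda_{\max})$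 there is a nonnegative supermartingale $(L_t)_{t\ge0}$ with $L_0\le1$ and $\exp\{\lambda\langle\theta,S_t\rangle-\psi(\lambda)\langle\theta,V_t\theta\rangle\}\le L_t$ almost surely for all $t\ge0$. **Theorem.** Suppose that $\psi$ is CGF-like on $[0,\lambda_{\max})$ with $\lambda_{\max}<\infty$, that $\lambda\mapsto\psi(\lambda)/\lambda^2$ is nondecreasing on $(0,\lambda_{\max})$, and that $\psi'''$ exists and is nonnegative on $(0,\lambda_{\max})$. Then there is a constant $C>0$, depending only on $\psi$ and $\lambda_{\max}$, such that the following holds for every $d\ge1$. Let $U_0\in\mathbb{R}^{d\times d}$ be positive definite with $\gamma_{\min}(U_0)^{-1}<\psi(\lambda_{\max})$, let $(S_t,V_t)$ be a sub-$\psi$ process with $V_t\succeq U_0$ for all $t\ge1$, and let $\delta\in(0,1)$. Then there is an event of probability at least $1-\delta$ on which, for all stopping times $\tau$ with $1\le\tau<\infty$ and $\gamma_{\min}(V_\tau)>1$, $$\|S_\tau\|_{V_\tau^{-1}}\;\le\; C\,(\psi^*)^{-1}\!\left(\frac{\log\det V_\tau+\log\log\big(\|S_\tau\|_{V_\tau^{-1}}\vee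 e^{e}\big)+\log(1/\delta)}{\sqrt{1-1/\gamma_{\min}(V_\tau)}}\right).$$ The conditions on $\tau$ are understood pointwise: at each outcome of the event, the bound holds whenever $1\le\tau<\infty$ and $\gamma_{\min}(V_\tau)>1$ at that outcome. -/

import Mathlib

open Set Filter Topology MeasureTheory ProbabilityTheory

namespace SelfNormalized

/-- `ψ : [0, lmax) → ℝ≥0` is CGF-like: strictly convex and twice continuously differentiable, with
`ψ(0) = 0` and `ψ'(0+) = 0`. Only the values of `ψ` on `[0, lmax)` matter. -/
structure IsCGFLike (ψ : ℝ → ℝ) (lmax : ℝ) : Prop where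
  nonneg : ∀ x ∈ Ico 0 lmax, 0 ≤ ψ x
  strictConvexOn : StrictConvexOn ℝ (Ico 0 lmax) ψ
  contDiffOn : ContDiffOn ℝ 2 ψ (Ico 0 lmax)
  map_zero : ψ 0 = 0
  tendsto_deriv : Tendsto (deriv ψ) (𝓝[>] 0) (𝓝 0)

/-- `ψ(λ)/λ²` is nondecreasing on `(0, lmax)`. -/
def IsSuperGaussian (ψ : ℝ → ℝ) (lmax : ℝ) : Prop :=
  MonotoneOn (fun x => ψ x / x ^ 2) (Ioo 0 lmax)

/-- The third derivative of `ψ` exists and is nonnegative on `(0, lmax)`. -/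
def HasNonnegThirdDeriv (ψ : ℝ → ℝ) (lmax : ℝ) : Prop :=
  ∀ x ∈ Ioo 0 lmax,
    DifferentiableAt ℝ (iteratedDeriv 2 ψ) x ∧ 0 ≤ iteratedDeriv 3 ψ x

/-- `ψ(lmax)`, the limit of `ψ(x)` as `x` increases to `lmax`; it may be `+∞`. -/
noncomputable def valueAtMax (ψ : ℝ → ℝ) (lmax : ℝ) : EReal :=
  Function.leftLim (fun x => (ψ x : EReal)) lmax

/-- The convex conjugate `ψ*(u) = sup_{x ∈ [0, lmax)} (x u - ψ(x))`. -/
noncomputable def conjugate (ψ : ℝ → ℝ) (lmax : ℝ) (u : ℝ) : ℝ :=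
  sSup ((fun x => x * u - ψ x) '' Ico 0 lmax)

/-- The inverse of `ψ* : [0, ∞) → [0, ∞)`; see `conjugate_bijOn`. -/
noncomputable def conjugateInv (ψ : ℝ → ℝ) (lmax : ℝ) : ℝ → ℝ :=
  Function.invFunOn (conjugate ψ lmax) (Ici 0)

/-- The smallest eigenvalue of a symmetric real matrix. -/
noncomputable def gammaMin {d : ℕ} (A : Matrix (Fin d) (Fin d) ℝ) : ℝ :=
  sInf (spectrum ℝ A)

/-- The norm `‖v‖_A = √⟨v, A v⟩`. -/
noncomputable def matNorm {d : ℕ} (A : Matrix (Fin d) (Fin d) ℝ) (v : Fin d → ℝ) : ℝ :=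
  √(v ⬝ᵥ A.mulVec v)

/-- `(S, V)` is a sub-`ψ` process: both are adapted, `V` is positive definite, and in each direction
`θ` of the Euclidean unit sphere and for each `l ∈ [0, lmax)` the exponential process is dominated
by a nonnegative supermartingale `L` that starts at `L 0 ≤ 1`. -/
structure IsSubPsi {Ω : Type*} {m : MeasurableSpace Ω} (P : Measure Ω) (𝓕 : Filtration ℕ m)
    {d : ℕ} (ψ : ℝ → ℝ) (lmax : ℝ)
    (S : ℕ → Ω → Fin d → ℝ) (V : ℕ → Ω → Matrix (Fin d) (Fin d) ℝ) : Prop where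
  adapted_S : StronglyAdapted 𝓕 S
  adapted_V : StronglyAdapted 𝓕 V
  posDef : ∀ t, ∀ᵐ ω ∂P, (V t ω).PosDef
  dominated : ∀ θ : Fin d → ℝ, θ ⬝ᵥ θ = 1 → ∀ l ∈ Ico 0 lmax,
    ∃ L : ℕ → Ω → ℝ, Supermartingale L 𝓕 P ∧ (∀ t, 0 ≤ᵐ[P] L t) ∧ (∀ᵐ ω ∂P, L 0 ω ≤ 1) ∧
      ∀ t, ∀ᵐ ω ∂P,
        Real.exp (l * (θ ⬝ᵥ S t ω) - ψ l * (θ ⬝ᵥ (V t ω).mulVec θ)) ≤ L t ω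

/-- `log log s`, with the usual convention that `s` is replaced by `max s (e ^ e)`, so that the
value is always at least `1`. -/
noncomputable def logLog (s : ℝ) : ℝ :=
  Real.log (Real.log (max s (Real.exp (Real.exp 1))))

theorem bddAbove_conjugate {ψ : ℝ → ℝ} {lmax : ℝ} (h : IsCGFLike ψ lmax) {u : ℝ} (hu : 0 ≤ u) :
    BddAbove ((fun x => x * u - ψ x) '' Ico 0 lmax) := by
  refine ⟨lmax * u, ?_⟩
  rintro _ ⟨x, hx, rfl⟩
  have h1 := h.nonneg x hx
  have h2 := mul_le_mul_of_nonneg_right hx.2.le hu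
  simp only
  linarith

/-- `ψ*` is a bijection from `[0, ∞)` onto `[0, ∞)`. -/
theorem conjugate_bijOn {ψ : ℝ → ℝ} {lmax : ℝ} (h : IsCGFLike ψ lmax) (hl : 0 < lmax) :
    BijOn (conjugate ψ lmax) (Ici 0) (Ici 0) := by
  have hle : ∀ u, 0 ≤ u → ∀ x ∈ Ico 0 lmax, x * u - ψ x ≤ conjugate ψ lmax u := fun u hu x hx =>
    le_csSup (bddAbove_conjugate h hu) ⟨x, hx, rfl⟩
  have hne : ∀ u, ((fun x => x * u - ψ x) '' Ico 0 lmax).Nonempty := fun u =>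
    ⟨_, 0, ⟨le_rfl, hl⟩, rfl⟩
  have h0 : ∀ u, 0 ≤ u → 0 ≤ conjugate ψ lmax u := by
    intro u hu
    have := hle u hu 0 ⟨le_rfl, hl⟩
    simpa [h.map_zero] using this
  have hzero : conjugate ψ lmax 0 = 0 := by
    refine le_antisymm (csSup_le (hne 0) ?_) (h0 0 le_rfl)
    rintro _ ⟨x, hx, rfl⟩
    have := h.nonneg x hx
    simp only
    linarith
  have hlip : ∀ u v, 0 ≤ u → u ≤ v → conjugate ψ lmax v ≤ conjugate ψ lmax u + lmax * (v - u) := by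
    intro u v hu huv
    refine csSup_le (hne v) ?_
    rintro _ ⟨x, hx, rfl⟩
    have h1 := hle u hu x hx
    have h2 := mul_le_mul_of_nonneg_right hx.2.le (sub_nonneg.2 huv)
    simp only
    linarith
  have hmono : MonotoneOn (conjugate ψ lmax) (Ici 0) := by
    intro u hu v hv huv
    refine csSup_le (hne u) ?_
    rintro _ ⟨x, hx, rfl⟩
    have h1 := hle v hv x hx
    have h2 := mul_le_mul_of_nonneg_left huv hx.1
    simp only
    linarith
  have hpos : ∀ u, 0 < u → 0 < conjugate ψ lmax u := by
    intro u hu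
    have h1 : ∀ᶠ x in 𝓝[>] (0 : ℝ), deriv ψ x < u :=
      h.tendsto_deriv.eventually (gt_mem_nhds hu)
    obtain ⟨b, hb, hb'⟩ := mem_nhdsGT_iff_exists_Ioo_subset.1 h1
    have hb0 : (0 : ℝ) < b := hb
    set x := min b lmax / 2 with hx
    have hm : 0 < min b lmax := lt_min hb0 hl
    have hx0 : 0 < x := by positivity
    have hxm : x < min b lmax := by rw [hx]; linarith
    have hxb : x < b := hxm.trans_le (min_le_left _ _)
    have hxl : x < lmax := hxm.trans_le (min_le_right _ _)
    have hsub : Icc 0 x ⊆ Ico 0 lmax := fun y hy => ⟨hy.1, hy.2.trans_lt hxl⟩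
    obtain ⟨c, hc, hc'⟩ := exists_deriv_eq_slope ψ hx0 (h.contDiffOn.continuousOn.mono hsub)
      (fun y hy => ((h.contDiffOn.differentiableOn (by norm_num)) y
        (hsub ⟨hy.1.le, hy.2.le⟩)).differentiableAt
          (Ico_mem_nhds hy.1 (hy.2.trans hxl)) |>.differentiableWithinAt)
    have h2 : deriv ψ c < u := hb' ⟨hc.1, hc.2.trans hxb⟩
    rw [hc', h.map_zero, sub_zero, sub_zero, div_lt_iff₀ hx0] at h2
    have h3 := hle u hu.le x ⟨hx0.le, hxl⟩
    linarith
  have hscale : ∀ u v, 0 < v → 0 ≤ u → u ≤ v →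
      v * conjugate ψ lmax u ≤ u * conjugate ψ lmax v := by
    intro u v hv hu huv
    have : conjugate ψ lmax u ≤ u * conjugate ψ lmax v / v := by
      refine csSup_le (hne u) ?_
      rintro _ ⟨x, hx, rfl⟩
      simp only
      rw [le_div_iff₀ hv]
      have h1 := mul_le_mul_of_nonneg_left (hle v hv.le x hx) hu
      have h2 := mul_le_mul_of_nonneg_right huv (h.nonneg x hx)
      nlinarith
    rw [le_div_iff₀ hv] at this
    linarith
  have hstrict : StrictMonoOn (conjugate ψ lmax) (Ici 0) := by
    intro u hu v hv huv
    have hu' : (0 : ℝ) ≤ u := hu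
    have hv' : 0 < v := hu'.trans_lt huv
    have h1 := hscale u v hv' hu huv.le
    have h2 := hpos v hv'
    have h3 : u * conjugate ψ lmax v < v * conjugate ψ lmax v := mul_lt_mul_of_pos_right huv h2
    exact lt_of_mul_lt_mul_left (h1.trans_lt h3) hv'.le
  refine ⟨fun u hu => h0 u hu, hstrict.injOn, ?_⟩
  intro y hy
  have hy' : (0 : ℝ) ≤ y := hy
  have hcont : ContinuousOn (conjugate ψ lmax) (Ici 0) := by
    have : LipschitzOnWith (Real.toNNReal lmax) (conjugate ψ lmax) (Ici 0) := by
      refine LipschitzOnWith.of_le_add_mul' lmax ?_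
      intro u hu v hv
      rcases le_total u v with huv | huv
      · have := hmono hu hv huv
        have := mul_nonneg hl.le (dist_nonneg (x := u) (y := v))
        linarith
      · have := hlip v u hv huv
        rwa [Real.dist_eq, abs_of_nonneg (sub_nonneg.2 huv)]
    exact this.continuousOn
  have h1 := hpos 1 one_pos
  set w := 1 + y / conjugate ψ lmax 1 with hw
  have hw1 : 1 ≤ w := by
    have : 0 ≤ y / conjugate ψ lmax 1 := by positivity
    linarith
  have h2 := hscale 1 w (by linarith) zero_le_one hw1
  have h3 : w * conjugate ψ lmax 1 = conjugate ψ lmax 1 + y := by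
    rw [hw]; field_simp
  have hmem : y ∈ Icc (conjugate ψ lmax 0) (conjugate ψ lmax w) := by
    rw [hzero]
    exact ⟨hy', by linarith⟩
  obtain ⟨z, hz, hz'⟩ := intermediate_value_Icc (by linarith : (0 : ℝ) ≤ w)
    (hcont.mono Icc_subset_Ici_self) hmem
  exact ⟨z, hz.1, hz'⟩

end SelfNormalized

/-! Since `lmax` is finite, `ψ*(u) ≤ lmax * u`, so `(ψ*)⁻¹(y) ≥ y / lmax`. It therefore suffices to
bound the self-normalized norm linearly in the argument of `(ψ*)⁻¹`, and one fixed `l` in `(0,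
lmax)` is enough for that: no optimization or stitching over `l`.

The method is a mixture over directions. Monotonicity of `ψ(x)/x²` extends the supermartingale
domination from the unit sphere to the unit ball at the same `l`
(`IsSubPsi.exists_supermartingale`). Averaging the exponential process uniformly over the ball and
applying Ville's inequality (`measure_exists_lt_lintegral_le`) bounds the mixture by `1/δ` at all
times simultaneously, hence at every stopping time.

Conversely, write `V = Rᵀ R` and substitute `y = R θ`. This costs a factor `√det V`, and the image
of the ball contains the ball of squared radius `g = γ_min(V) > 1`. The excess over `1` leaves room
to shift a half ball by `√(1 - 1/g)` towards the whitened vector, which makes the mixture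
exponentially large in `‖S‖_{V⁻¹}` (`volume_mul_exp_le_lintegral_unitBall`). Comparing the two
bounds gives `matNorm_mul_le`; the remaining additive constants are absorbed because the iterated
logarithm is at least `1`. -/

namespace SelfNormalized

open scoped ENNReal

/-! ### Ville's inequality for mixtures -/

section Maximal

variable {Ω : Type*} {m : MeasurableSpace Ω} {P : Measure Ω} {𝓕 : Filtration ℕ m}

/-- The value of a nonnegative supermartingale, collected over disjoint events that are known at
their respective times, has total expectation at most its initial expectation. -/
theorem sum_setIntegral_le [IsProbabilityMeasure P] {L : ℕ → Ω → ℝ} (hL : Supermartingale L 𝓕 P)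
    (h0 : ∀ t, 0 ≤ᵐ[P] L t) {A : ℕ → Set Ω} (hA : ∀ t, MeasurableSet[𝓕 t] (A t))
    (hd : Pairwise (Function.onFun Disjoint A)) (n : ℕ) :
    ∑ t ∈ Finset.range n, ∫ ω in A t, L t ω ∂P ≤ ∫ ω, L 0 ω ∂P := by
  have hm : ∀ n, MeasurableSet[𝓕 n] (⋃ t ∈ Finset.range n, A t)ᶜ := fun n =>
    (Finset.measurableSet_biUnion _ fun t ht =>
      𝓕.mono (Finset.mem_range.1 ht).le _ (hA t)).compl
  have key : ∑ t ∈ Finset.range n, ∫ ω in A t, L t ω ∂P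
      + ∫ ω in (⋃ t ∈ Finset.range n, A t)ᶜ, L n ω ∂P ≤ ∫ ω, L 0 ω ∂P := by
    induction n with
    | zero => simp
    | succ n ih =>
      have hAn := 𝓕.le n _ (hA n)
      have hsub : (⋃ t ∈ Finset.range n, A t)ᶜ
          = A n ∪ (⋃ t ∈ Finset.range (n + 1), A t)ᶜ := by
        ext ω
        simp only [mem_compl_iff, mem_iUnion, Finset.mem_range, not_exists, mem_union]
        constructor
        · intro h
          by_cases hω : ω ∈ A n
          · exact Or.inl hω
          · refine Or.inr fun t ht => ?_
            rcases Nat.lt_succ_iff_lt_or_eq.1 ht with h1 | rfl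
            · exact h t h1
            · exact hω
        · rintro (h | h) t ht
          · exact fun h' => disjoint_left.1 (hd ht.ne) h' h
          · exact h t (by omega)
      have hdj : Disjoint (A n) (⋃ t ∈ Finset.range (n + 1), A t)ᶜ := by
        refine disjoint_compl_right_iff_subset.2 ?_
        exact Finset.subset_set_biUnion_of_mem (Finset.self_mem_range_succ n)
      rw [hsub, setIntegral_union hdj (𝓕.le _ _ (hm (n + 1)))
        (hL.integrable n).integrableOn (hL.integrable n).integrableOn] at ih
      have hstep : ∫ ω in (⋃ t ∈ Finset.range (n + 1), A t)ᶜ, L (n + 1) ω ∂P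
          ≤ ∫ ω in (⋃ t ∈ Finset.range (n + 1), A t)ᶜ, L n ω ∂P := by
        -- The complement of `A 0, …, A n` is already known at time `n`, so the supermartingale step
        -- from `n` to `n + 1` applies on it.
        have hmn : MeasurableSet[𝓕 n] (⋃ t ∈ Finset.range (n + 1), A t)ᶜ :=
          (Finset.measurableSet_biUnion _ fun t ht =>
            𝓕.mono (Nat.lt_succ_iff.1 (Finset.mem_range.1 ht)) _ (hA t)).compl
        exact hL.setIntegral_le n.le_succ hmn
      rw [Finset.sum_range_succ]
      linarith
  have : 0 ≤ ∫ ω in (⋃ t ∈ Finset.range n, A t)ᶜ, L n ω ∂P :=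
    setIntegral_nonneg_of_ae (h0 n)
  linarith

/-- The statement of `sum_setIntegral_le` for a process dominated by a nonnegative
supermartingale. -/
theorem tsum_setLIntegral_le_one [IsProbabilityMeasure P] {L : ℕ → Ω → ℝ}
    (hL : Supermartingale L 𝓕 P) (h0 : ∀ t, 0 ≤ᵐ[P] L t) (h1 : ∀ᵐ ω ∂P, L 0 ω ≤ 1)
    {X : ℕ → Ω → ℝ} (hX : ∀ t, ∀ᵐ ω ∂P, X t ω ≤ L t ω)
    {A : ℕ → Set Ω} (hA : ∀ t, MeasurableSet[𝓕 t] (A t))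
    (hd : Pairwise (Function.onFun Disjoint A)) :
    ∑' t, ∫⁻ ω in A t, ENNReal.ofReal (X t ω) ∂P ≤ 1 := by
  refine ENNReal.tsum_le_of_sum_range_le fun n => ?_
  have hle : ∀ t, ∫⁻ ω in A t, ENNReal.ofReal (X t ω) ∂P
      ≤ ENNReal.ofReal (∫ ω in A t, L t ω ∂P) := fun t => by
    rw [ofReal_integral_eq_lintegral_ofReal (hL.integrable t).integrableOn
      (ae_restrict_of_ae (h0 t))]
    refine lintegral_mono_ae (ae_restrict_of_ae ?_)
    filter_upwards [hX t] with ω h using ENNReal.ofReal_le_ofReal h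
  calc ∑ t ∈ Finset.range n, ∫⁻ ω in A t, ENNReal.ofReal (X t ω) ∂P
      ≤ ∑ t ∈ Finset.range n, ENNReal.ofReal (∫ ω in A t, L t ω ∂P) :=
        Finset.sum_le_sum fun t _ => hle t
    _ = ENNReal.ofReal (∑ t ∈ Finset.range n, ∫ ω in A t, L t ω ∂P) :=
        (ENNReal.ofReal_sum_of_nonneg fun t _ => setIntegral_nonneg_of_ae (h0 t)).symm
    _ ≤ ENNReal.ofReal 1 := by
        refine ENNReal.ofReal_le_ofReal ((sum_setIntegral_le hL h0 hA hd n).trans ?_)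
        have := integral_mono_ae (hL.integrable 0) (integrable_const (μ := P) (1 : ℝ)) h1
        simpa using this
    _ = 1 := ENNReal.ofReal_one

/-- Ville's inequality for a mixture of processes, each of which satisfies the conclusion of
`tsum_setLIntegral_le_one`. -/
theorem measure_exists_lt_lintegral_le {Θ : Type*} [MeasurableSpace Θ] {ν : Measure Θ} [SFinite ν]
    [SFinite P] {X : ℕ → Ω → Θ → ℝ≥0∞}
    (hX : ∀ t, Measurable[(𝓕 t).prod inferInstance] (Function.uncurry (X t)))
    (hle : ∀ A : ℕ → Set Ω, (∀ t, MeasurableSet[𝓕 t] (A t)) →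
      Pairwise (Function.onFun Disjoint A) →
      ∀ᵐ θ ∂ν, ∑' t, ∫⁻ ω in A t, X t ω θ ∂P ≤ 1) (c : ℝ≥0∞) :
    (∀ t, MeasurableSet[𝓕 t] {ω | c < ∫⁻ θ, X t ω θ ∂ν}) ∧
      c * P {ω | ∃ t, c < ∫⁻ θ, X t ω θ ∂ν} ≤ ν univ := by
  set E : ℕ → Set Ω := fun t => {ω | c < ∫⁻ θ, X t ω θ ∂ν} with hE
  have hEm : ∀ t, MeasurableSet[𝓕 t] (E t) := fun t => by
    let := 𝓕 t
    exact measurableSet_lt measurable_const (hX t).lintegral_prod_right'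
  refine ⟨hEm, ?_⟩
  have hA : ∀ t, MeasurableSet[𝓕 t] (disjointed E t) := fun t => by
    rw [disjointed_eq_inter_compl]
    refine (hEm t).inter (MeasurableSet.biInter (to_countable _) fun j hj => ?_)
    exact (𝓕.mono (le_of_lt hj) _ (hEm j)).compl
  have hXm : ∀ t, Measurable (Function.uncurry (X t)) := fun t =>
    (hX t).mono (sup_le_sup (MeasurableSpace.comap_mono (𝓕.le t)) le_rfl) le_rfl
  have hset : {ω | ∃ t, c < ∫⁻ θ, X t ω θ ∂ν} = ⋃ t, disjointed E t := by
    rw [iUnion_disjointed]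
    ext ω
    simp [hE]
  rw [hset, measure_iUnion (disjoint_disjointed E) fun t => 𝓕.le t _ (hA t),
    ← ENNReal.tsum_mul_left]
  calc ∑' t, c * P (disjointed E t)
      ≤ ∑' t, ∫⁻ ω in disjointed E t, ∫⁻ θ, X t ω θ ∂ν ∂P := by
        refine ENNReal.tsum_le_tsum fun t => ?_
        rw [← setLIntegral_const]
        exact setLIntegral_mono' (𝓕.le t _ (hA t)) fun ω hω => (disjointed_subset E t hω).le
    -- Tonelli is applied to `X`, not to the dominating supermartingales: these are chosen
    -- separately for each `θ` and need not be measurable in `θ`.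
    _ = ∑' t, ∫⁻ θ, ∫⁻ ω in disjointed E t, X t ω θ ∂P ∂ν :=
        tsum_congr fun t => lintegral_lintegral_swap (hXm t).aemeasurable
    _ = ∫⁻ θ, ∑' t, ∫⁻ ω in disjointed E t, X t ω θ ∂P ∂ν := by
        rw [lintegral_tsum fun t => ?_]
        exact ((hXm t).lintegral_prod_left' (μ := P.restrict (disjointed E t))).aemeasurable
    _ ≤ ∫⁻ _, 1 ∂ν := lintegral_mono_ae (hle _ hA (disjoint_disjointed E))
    _ = ν univ := by simp

end Maximal

/-! ### Smallest eigenvalue, determinant and factorization -/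

section Matrix

variable {d : ℕ} {V : Matrix (Fin d) (Fin d) ℝ}

theorem gammaMin_le_of_mem_spectrum {x : ℝ} (hx : x ∈ spectrum ℝ V) : gammaMin V ≤ x :=
  csInf_le (Matrix.finite_real_spectrum (A := V)).bddBelow hx

theorem gammaMin_mul_dotProduct_le (hV : V.IsHermitian) (x : Fin d → ℝ) :
    gammaMin V * (x ⬝ᵥ x) ≤ x ⬝ᵥ V.mulVec x := by
  have hH : (V - algebraMap ℝ _ (gammaMin V)).IsHermitian :=
    hV.sub (IsSelfAdjoint.algebraMap _ (IsSelfAdjoint.all (gammaMin V)))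
  have h : (V - algebraMap ℝ _ (gammaMin V)).PosSemidef := by
    refine Matrix.posSemidef_iff_isHermitian_and_spectrum_nonneg.2 ⟨hH, ?_⟩
    rw [← spectrum.sub_singleton_eq]
    rintro _ ⟨y, hy, _, rfl, rfl⟩
    exact sub_nonneg.2 (gammaMin_le_of_mem_spectrum hy)
  have := h.dotProduct_mulVec_nonneg x
  rw [Matrix.sub_mulVec, dotProduct_sub, Algebra.algebraMap_eq_smul_one, Matrix.smul_mulVec,
    Matrix.one_mulVec, dotProduct_smul] at this
  simpa using this

theorem one_le_det_of_one_le_gammaMin (hV : V.IsHermitian) (h : 1 ≤ gammaMin V) : 1 ≤ V.det := by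
  rw [hV.det_eq_prod_eigenvalues]
  have hi : ∀ i, 1 ≤ hV.eigenvalues i := fun i => h.trans <| gammaMin_le_of_mem_spectrum <| by
    rw [hV.spectrum_real_eq_range_eigenvalues]
    exact mem_range_self i
  calc (1 : ℝ) = ∏ _i : Fin d, 1 := by simp
    _ ≤ ∏ i, hV.eigenvalues i := Finset.prod_le_prod (fun _ _ => zero_le_one) fun i _ => hi i
    _ = _ := by simp

open scoped MatrixOrder in
theorem exists_eq_transpose_mul_self (hV : V.PosSemidef) :
    ∃ R : Matrix (Fin d) (Fin d) ℝ, V = R.transpose * R := by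
  obtain ⟨R, hR⟩ := CStarAlgebra.nonneg_iff_eq_star_mul_self.mp hV.nonneg
  exact ⟨R, by simpa [Matrix.star_eq_conjTranspose] using hR⟩

end Matrix

/-! ### Volume of the Euclidean ball -/

section UnitBall

variable (d : ℕ)

/-- The closed Euclidean unit ball of `ℝᵈ`. -/
def unitBall : Set (Fin d → ℝ) := {x | x ⬝ᵥ x ≤ 1}

theorem continuous_dotProduct_self : Continuous fun x : Fin d → ℝ => x ⬝ᵥ x := by
  unfold dotProduct; fun_prop

theorem measurableSet_unitBall : MeasurableSet (unitBall d) :=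
  (isClosed_le (continuous_dotProduct_self d) continuous_const).measurableSet

theorem volume_unitBall_ne_top : volume (unitBall d) ≠ ∞ := by
  refine ((measure_mono ?_).trans_lt (isCompact_Icc (a := fun _ : Fin d => (-1 : ℝ))
    (b := fun _ => 1)).measure_lt_top).ne
  intro x hx
  have h : ∀ i, x i * x i ≤ 1 := fun i =>
    (Finset.single_le_sum (f := fun i => x i * x i) (fun i _ => mul_self_nonneg _)
      (Finset.mem_univ i)).trans hx
  exact ⟨fun i => by nlinarith [h i], fun i => by nlinarith [h i]⟩

theorem volume_unitBall_ne_zero : volume (unitBall d) ≠ 0 := by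
  have ho : IsOpen {x : Fin d → ℝ | x ⬝ᵥ x < 1} :=
    isOpen_lt (continuous_dotProduct_self d) continuous_const
  refine ((ho.measure_pos volume ⟨0, by simp⟩).trans_le (measure_mono fun x hx => ?_)).ne'
  have hx' : x ⬝ᵥ x < 1 := hx
  exact hx'.le

/-- A half ball has at least half of the volume of the ball. -/
theorem volume_unitBall_le_two_mul (b : Fin d → ℝ) :
    volume (unitBall d) ≤ 2 * volume (unitBall d ∩ {x | 0 ≤ x ⬝ᵥ b}) := by
  set H := unitBall d ∩ {x | 0 ≤ x ⬝ᵥ b} with hH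
  have hsub : unitBall d ⊆ H ∪ Neg.neg ⁻¹' H := by
    intro x hx
    have hx' : x ⬝ᵥ x ≤ 1 := hx
    rcases le_total 0 (x ⬝ᵥ b) with h | h
    · exact Or.inl ⟨hx, h⟩
    · refine Or.inr ⟨?_, ?_⟩
      · simpa [unitBall] using hx'
      · simpa using h
  refine (measure_mono hsub).trans ((measure_union_le _ _).trans ?_)
  rw [Measure.measure_preimage_neg, two_mul]

end UnitBall

/-! ### Lower bound for the mixture integral -/

section Integral

variable {d : ℕ}

/-- Exponential tilting of a slightly enlarged unit ball in a direction `b`. -/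
theorem volume_mul_exp_le_lintegral {b : Fin d → ℝ} {l k s N g : ℝ} (hk : 0 ≤ k)
    (hs : 0 ≤ s) (hs1 : s ^ 2 ≤ 1) (hsg : s ^ 2 + 1 ≤ g) (hN : 0 ≤ N) (hb : b ⬝ᵥ b = N ^ 2) :
    volume (unitBall d) * ENNReal.ofReal (Real.exp (l * N * s / 2 - 2 * k)) ≤
      2 * ∫⁻ y in {y : Fin d → ℝ | y ⬝ᵥ y ≤ g},
        ENNReal.ofReal (Real.exp (l * (y ⬝ᵥ b) - k * (y ⬝ᵥ y))) := by
  set K := {y : Fin d → ℝ | y ⬝ᵥ y ≤ g} with hK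
  have hKm : MeasurableSet K :=
    (isClosed_le (continuous_dotProduct_self d) continuous_const).measurableSet
  set f : (Fin d → ℝ) → ℝ≥0∞ := fun y =>
    ENNReal.ofReal (Real.exp (l * (y ⬝ᵥ b) - k * (y ⬝ᵥ y))) with hf
  have hfm : Measurable f := by
    have : Continuous fun y : Fin d → ℝ => Real.exp (l * (y ⬝ᵥ b) - k * (y ⬝ᵥ y)) := by
      unfold dotProduct; fun_prop
    exact this.measurable.ennreal_ofReal
  set F := K.indicator f with hF
  have hFm : Measurable F := hfm.indicator hKm
  set H := unitBall d ∩ {x | 0 ≤ x ⬝ᵥ b} with hH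
  have hHm : MeasurableSet H := by
    refine (measurableSet_unitBall d).inter (isClosed_le continuous_const ?_).measurableSet
    unfold dotProduct; fun_prop
  -- If `N = 0` then `e = 0` because `0⁻¹ = 0`; hence only `e ⬝ᵥ e ≤ 1` is claimed below.
  set e := N⁻¹ • b with he
  have heb : e ⬝ᵥ b = N := by
    rw [he, smul_dotProduct, hb, smul_eq_mul]
    rcases eq_or_ne N 0 with h | h
    · simp [h]
    · field_simp
  have hee : e ⬝ᵥ e ≤ 1 := by
    rw [he, dotProduct_smul, ← he, heb, smul_eq_mul]
    exact inv_mul_le_one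
  set w := ENNReal.ofReal (Real.exp (l * N * s / 2 - 2 * k)) with hw
  -- Pair `z` with its reflection `s • e - z`. Their products with `b` add up to `s * N`, so AM-GM
  -- bounds the two exponentials below jointly. Since `e ⬝ᵥ z ≥ 0` on the half ball, the reflected
  -- point has squared norm at most `s ^ 2 + 1 ≤ min g 2`; the bound `2` yields the loss `2 * k`.
  have hpt : ∀ z ∈ H, 2 * w ≤ F z + F (s • e - z) := by
    rintro z ⟨hz1, hz2⟩
    have hz1' : z ⬝ᵥ z ≤ 1 := hz1
    have hz2' : 0 ≤ z ⬝ᵥ b := hz2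
    have hez : 0 ≤ e ⬝ᵥ z := by
      rw [he, smul_dotProduct, dotProduct_comm]
      exact mul_nonneg (inv_nonneg.2 hN) hz2'
    have hsq : (s • e - z) ⬝ᵥ (s • e - z) ≤ s ^ 2 + 1 := by
      simp only [sub_dotProduct, dotProduct_sub, smul_dotProduct, dotProduct_smul, smul_eq_mul]
      rw [dotProduct_comm z e]
      nlinarith [mul_nonneg hs hez, mul_le_mul_of_nonneg_left hee (sq_nonneg s)]
    have hlin : (s • e - z) ⬝ᵥ b = s * N - z ⬝ᵥ b := by
      rw [sub_dotProduct, smul_dotProduct, heb, smul_eq_mul]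
    have m1 : z ∈ K := show z ⬝ᵥ z ≤ g by nlinarith
    have m2 : s • e - z ∈ K := hsq.trans hsg
    rw [hF, indicator_of_mem m1, indicator_of_mem m2, hf]
    simp only
    rw [← ENNReal.ofReal_add (Real.exp_nonneg _) (Real.exp_nonneg _), hw,
      ← ENNReal.ofReal_ofNat 2, ← ENNReal.ofReal_mul (by norm_num), hlin]
    refine ENNReal.ofReal_le_ofReal ?_
    set a := z ⬝ᵥ b
    have e1 : Real.exp (l * a - 2 * k) ≤ Real.exp (l * a - k * (z ⬝ᵥ z)) :=
      Real.exp_le_exp.2 (by nlinarith)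
    have e2 : Real.exp (l * (s * N - a) - 2 * k)
        ≤ Real.exp (l * (s * N - a) - k * ((s • e - z) ⬝ᵥ (s • e - z))) :=
      Real.exp_le_exp.2 (by nlinarith)
    have e3 : Real.exp (l * N * s / 2 - 2 * k) ^ 2
        = Real.exp (l * a - 2 * k) * Real.exp (l * (s * N - a) - 2 * k) := by
      rw [sq, ← Real.exp_add, ← Real.exp_add]
      congr 1; ring
    have p1 := Real.exp_pos (l * a - 2 * k)
    have p2 := Real.exp_pos (l * (s * N - a) - 2 * k)
    have p3 := Real.exp_pos (l * N * s / 2 - 2 * k)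
    have : 2 * Real.exp (l * N * s / 2 - 2 * k)
        ≤ Real.exp (l * a - 2 * k) + Real.exp (l * (s * N - a) - 2 * k) := by
      refine abs_le_of_sq_le_sq' ?_ (by positivity) |>.2
      nlinarith [sq_nonneg (Real.exp (l * a - 2 * k) - Real.exp (l * (s * N - a) - 2 * k))]
    linarith
  have hrefl : ∫⁻ z, F (s • e - z) = ∫⁻ z, F z := lintegral_sub_left_eq_self F _
  calc volume (unitBall d) * w ≤ 2 * volume H * w := by
        gcongr; exact volume_unitBall_le_two_mul d b
    _ = ∫⁻ _ in H, 2 * w := by rw [setLIntegral_const]; ring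
    _ ≤ ∫⁻ z in H, (F z + F (s • e - z)) := setLIntegral_mono' hHm hpt
    _ ≤ ∫⁻ z, (F z + F (s • e - z)) := setLIntegral_le_lintegral _ _
    _ = 2 * ∫⁻ z, F z := by rw [lintegral_add_left hFm, hrefl, two_mul]
    _ = 2 * ∫⁻ z in K, f z := by rw [hF, lintegral_indicator hKm]

/-- Lower bound for the mixture of the exponential process over the unit ball. -/
theorem volume_mul_exp_le_lintegral_unitBall {V : Matrix (Fin d) (Fin d) ℝ} (hV : V.PosDef)
    (hg : 1 < gammaMin V) (S : Fin d → ℝ) {l k : ℝ} (hk : 0 ≤ k) :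
    volume (unitBall d) * ENNReal.ofReal
        (Real.exp (l * matNorm V⁻¹ S * √(1 - 1 / gammaMin V) / 2 - 2 * k)) ≤
      2 * (ENNReal.ofReal √V.det * ∫⁻ θ in unitBall d,
        ENNReal.ofReal (Real.exp (l * (θ ⬝ᵥ S) - k * (θ ⬝ᵥ V.mulVec θ)))) := by
  obtain ⟨R, hR⟩ := exists_eq_transpose_mul_self hV.posSemidef
  have hdet : V.det = R.det ^ 2 := by rw [hR, Matrix.det_mul, Matrix.det_transpose, sq]
  have hR0 : R.det ≠ 0 := by
    intro h
    have := hV.det_pos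
    rw [hdet, h] at this
    simp at this
  have hRu : IsUnit R.det := isUnit_iff_ne_zero.2 hR0
  set b := (R⁻¹).transpose.mulVec S with hb
  have hquad : ∀ θ, θ ⬝ᵥ V.mulVec θ = R.mulVec θ ⬝ᵥ R.mulVec θ := fun θ => by
    rw [hR, ← Matrix.mulVec_mulVec, Matrix.dotProduct_mulVec, Matrix.vecMul_transpose]
  have hlin : ∀ θ, θ ⬝ᵥ S = R.mulVec θ ⬝ᵥ b := fun θ => by
    rw [hb, Matrix.dotProduct_mulVec, Matrix.vecMul_transpose, Matrix.mulVec_mulVec,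
      Matrix.nonsing_inv_mul _ hRu, Matrix.one_mulVec]
  have hbb : b ⬝ᵥ b = S ⬝ᵥ V⁻¹.mulVec S := by
    rw [hR, Matrix.mul_inv_rev, ← Matrix.mulVec_mulVec, ← Matrix.transpose_nonsing_inv, ← hb,
      Matrix.dotProduct_mulVec S, ← Matrix.mulVec_transpose]
  have hN : b ⬝ᵥ b = matNorm V⁻¹ S ^ 2 := by
    rw [matNorm, Real.sq_sqrt, hbb]
    rw [← hbb]
    exact Finset.sum_nonneg fun i _ => mul_self_nonneg (b i)
  set g := gammaMin V with hgdef
  have hg0 : 0 < g := one_pos.trans hg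
  have hs0 : 0 ≤ 1 - 1 / g := by
    rw [sub_nonneg, div_le_one hg0]; exact hg.le
  have hs2 : √(1 - 1 / g) ^ 2 = 1 - 1 / g := Real.sq_sqrt hs0
  have hs1 : √(1 - 1 / g) ^ 2 ≤ 1 := by
    have : 0 < 1 / g := by positivity
    linarith
  -- The shift must satisfy `s² ≤ min 1 (g - 1)`; `s² = 1 - 1/g` does.
  have hsg : √(1 - 1 / g) ^ 2 + 1 ≤ g := by
    have h1 : g - (1 - 1 / g + 1) = (g - 1) ^ 2 / g := by field_simp; ring
    have h2 : 0 ≤ (g - 1) ^ 2 / g := by positivity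
    linarith
  have hmain := volume_mul_exp_le_lintegral (l := l) hk (Real.sqrt_nonneg _) hs1 hsg
    (Real.sqrt_nonneg _) hN
  refine hmain.trans (mul_le_mul_right ?_ _)
  set f : (Fin d → ℝ) → ℝ≥0∞ := fun y =>
    ENNReal.ofReal (Real.exp (l * (y ⬝ᵥ b) - k * (y ⬝ᵥ y))) with hf
  have hfm : Measurable f := by
    have : Continuous fun y : Fin d → ℝ => Real.exp (l * (y ⬝ᵥ b) - k * (y ⬝ᵥ y)) := by
      unfold dotProduct; fun_prop
    exact this.measurable.ennreal_ofReal
  have hKm : MeasurableSet {y : Fin d → ℝ | y ⬝ᵥ y ≤ g} :=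
    (isClosed_le (continuous_dotProduct_self d) continuous_const).measurableSet
  have hRm : Measurable (Matrix.toLin' R) :=
    (LinearMap.continuous_of_finiteDimensional _).measurable
  have hvol : (volume : Measure (Fin d → ℝ))
      = ENNReal.ofReal √V.det • Measure.map (Matrix.toLin' R) volume := by
    rw [Real.map_matrix_volume_pi_eq_smul_volume_pi hR0, smul_smul, hdet, Real.sqrt_sq_eq_abs,
      ← ENNReal.ofReal_mul (abs_nonneg _), ← abs_mul, mul_inv_cancel₀ hR0, abs_one,
      ENNReal.ofReal_one, one_smul]
  rw [hvol, Measure.restrict_smul, lintegral_smul_measure, smul_eq_mul, ← hvol]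
  refine mul_le_mul_right ?_ _
  rw [Measure.restrict_map hRm hKm, lintegral_map hfm hRm]
  have hcongr : ∀ θ, f (Matrix.toLin' R θ)
      = ENNReal.ofReal (Real.exp (l * (θ ⬝ᵥ S) - k * (θ ⬝ᵥ V.mulVec θ))) := fun θ => by
    rw [hf, Matrix.toLin'_apply, hquad, hlin]
  simp_rw [hcongr]
  -- If `|R θ|² ≤ g`, then `g |θ|² ≤ θᵀ V θ = |R θ|² ≤ g`, so `θ` lies in the unit ball.
  refine lintegral_mono_set fun θ hθ => ?_
  have h1 : R.mulVec θ ⬝ᵥ R.mulVec θ ≤ g := hθ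
  rw [← hquad] at h1
  have h2 := gammaMin_mul_dotProduct_le hV.isHermitian θ
  exact le_of_mul_le_mul_left (by linarith) hg0

end Integral

/-! ### Growth of the inverse conjugate and scaling of `ψ` -/

section Conjugate

variable {ψ : ℝ → ℝ} {lmax : ℝ}

/-- The inverse conjugate grows at least linearly. -/
theorem le_mul_conjugateInv (h : IsCGFLike ψ lmax) (hl : 0 < lmax) {y : ℝ} (hy : 0 ≤ y) :
    y ≤ lmax * conjugateInv ψ lmax y := by
  have hmem : y ∈ conjugate ψ lmax '' Ici 0 := (conjugate_bijOn h hl).surjOn hy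
  have h0 : 0 ≤ conjugateInv ψ lmax y := Function.invFunOn_mem hmem
  have heq : conjugate ψ lmax (conjugateInv ψ lmax y) = y := Function.invFunOn_eq hmem
  conv_lhs => rw [← heq]
  refine csSup_le ⟨_, 0, ⟨le_rfl, hl⟩, rfl⟩ ?_
  rintro _ ⟨x, hx, rfl⟩
  have h1 := h.nonneg x hx
  have h2 := mul_le_mul_of_nonneg_right hx.2.le h0
  simp only
  linarith

/-- Compare `ψ(x)/x²` at `l * r ≤ l`. The factor `r ^ 2` matches the quadratic form of a vector of
length `r`, which is what allows passing from unit vectors to the ball. -/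
theorem IsSuperGaussian.map_mul_le (h : IsSuperGaussian ψ lmax) {l r : ℝ} (hl : l ∈ Ioo 0 lmax)
    (hr : 0 < r) (hr1 : r ≤ 1) : ψ (l * r) ≤ r ^ 2 * ψ l := by
  have hle : l * r ≤ l := mul_le_of_le_one_right hl.1.le hr1
  have hpos : 0 < l * r := mul_pos hl.1 hr
  have := h ⟨hpos, hle.trans_lt hl.2⟩ hl hle
  simp only at this
  rw [div_le_div_iff₀ (by positivity) (pow_pos hl.1 2)] at this
  have hl2 := pow_pos hl.1 2
  refine le_of_mul_le_mul_right ?_ hl2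
  nlinarith

end Conjugate

/-! ### Time-uniform bound for the sub-`ψ` mixture -/

section SubPsi

variable {Ω : Type*} {m : MeasurableSpace Ω} {P : Measure Ω} {𝓕 : Filtration ℕ m} {d : ℕ}
  {ψ : ℝ → ℝ} {lmax : ℝ} {S : ℕ → Ω → Fin d → ℝ} {V : ℕ → Ω → Matrix (Fin d) (Fin d) ℝ}

/-- The exponential process of a sub-`ψ` process in a direction of the unit ball is dominated by a
nonnegative supermartingale. -/
theorem IsSubPsi.exists_supermartingale [IsProbabilityMeasure P]
    (h : IsSubPsi P 𝓕 ψ lmax S V) (hsg : IsSuperGaussian ψ lmax) {l : ℝ} (hl : l ∈ Ioo 0 lmax)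
    {θ : Fin d → ℝ} (hθ : θ ∈ unitBall d) :
    ∃ L : ℕ → Ω → ℝ, Supermartingale L 𝓕 P ∧ (∀ t, 0 ≤ᵐ[P] L t) ∧ (∀ᵐ ω ∂P, L 0 ω ≤ 1) ∧
      ∀ t, ∀ᵐ ω ∂P,
        Real.exp (l * (θ ⬝ᵥ S t ω) - ψ l * (θ ⬝ᵥ (V t ω).mulVec θ)) ≤ L t ω := by
  -- The origin has no direction to normalize; there the exponential process is constantly `1`.
  rcases eq_or_ne θ 0 with rfl | h0
  · refine ⟨fun _ _ => 1, (martingale_const 𝓕 P (1 : ℝ)).supermartingale,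
      fun t => ae_of_all _ fun _ => zero_le_one, ae_of_all _ fun _ => le_rfl,
      fun t => ae_of_all _ fun ω => by simp⟩
  have hpos : 0 < θ ⬝ᵥ θ := by
    refine lt_of_le_of_ne (Finset.sum_nonneg fun i _ => mul_self_nonneg (θ i)) fun h' => h0 ?_
    exact dotProduct_self_eq_zero.1 h'.symm
  set r := √(θ ⬝ᵥ θ) with hr
  have hr0 : 0 < r := Real.sqrt_pos.2 hpos
  have hr1 : r ≤ 1 := Real.sqrt_le_one.2 hθ
  have hrr : r ^ 2 = θ ⬝ᵥ θ := Real.sq_sqrt hpos.le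
  set u := r⁻¹ • θ with hu
  have hθu : θ = r • u := by rw [hu, smul_smul, mul_inv_cancel₀ hr0.ne', one_smul]
  have huu : u ⬝ᵥ u = 1 := by
    rw [hu, smul_dotProduct, dotProduct_smul, ← hrr, smul_eq_mul, smul_eq_mul]
    field_simp
  have hle : l * r ≤ l := mul_le_of_le_one_right hl.1.le hr1
  obtain ⟨L, hL, hL0, hL1, hdom⟩ := h.dominated u huu (l * r)
    ⟨(mul_pos hl.1 hr0).le, hle.trans_lt hl.2⟩
  refine ⟨L, hL, hL0, hL1, fun t => ?_⟩
  filter_upwards [hdom t, h.posDef t] with ω hω hV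
  refine le_trans (Real.exp_le_exp.2 ?_) hω
  have hq : 0 ≤ u ⬝ᵥ (V t ω).mulVec u := by
    simpa using hV.posSemidef.dotProduct_mulVec_nonneg u
  have := mul_le_mul_of_nonneg_right (hsg.map_mul_le hl hr0 hr1) hq
  clear_value r u
  rw [hθu, smul_dotProduct, smul_dotProduct, Matrix.mulVec_smul, dotProduct_smul]
  simp only [smul_eq_mul]
  nlinarith

/-- Time-uniform bound for the mixture of the exponential process over the unit ball. -/
theorem IsSubPsi.exists_measurableSet_lintegral_le [IsProbabilityMeasure P]
    (h : IsSubPsi P 𝓕 ψ lmax S V) (hsg : IsSuperGaussian ψ lmax) {l : ℝ} (hl : l ∈ Ioo 0 lmax)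
    {δ : ℝ} (hδ : 0 < δ) :
    ∃ A : Set Ω, MeasurableSet A ∧ ENNReal.ofReal (1 - δ) ≤ P A ∧ ∀ ω ∈ A, ∀ t,
      ∫⁻ θ in unitBall d,
          ENNReal.ofReal (Real.exp (l * (θ ⬝ᵥ S t ω) - ψ l * (θ ⬝ᵥ (V t ω).mulVec θ)))
        ≤ volume (unitBall d) * ENNReal.ofReal (1 / δ) := by
  set X : ℕ → Ω → (Fin d → ℝ) → ℝ≥0∞ := fun t ω θ =>
    ENNReal.ofReal (Real.exp (l * (θ ⬝ᵥ S t ω) - ψ l * (θ ⬝ᵥ (V t ω).mulVec θ))) with hX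
  have hXm : ∀ t, Measurable[(𝓕 t).prod inferInstance] (Function.uncurry (X t)) := fun t => by
    let := 𝓕 t
    have hS : Measurable (S t) := (h.adapted_S t).measurable
    have hV : ∀ i j, Measurable fun ω => V t ω i j := fun i j =>
      ((continuous_apply_apply i j).comp_stronglyMeasurable (h.adapted_V t)).measurable
    have hSi : ∀ i, Measurable fun ω => S t ω i := fun i => (measurable_pi_apply i).comp hS
    refine (Real.measurable_exp.comp ?_).ennreal_ofReal
    have hsum : Measurable fun p : Ω × (Fin d → ℝ) =>
        l * (∑ i, p.2 i * S t p.1 i) - ψ l * ∑ i, p.2 i * ∑ j, V t p.1 i j * p.2 j := by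
      have hS' : ∀ i, Measurable fun p : Ω × (Fin d → ℝ) => S t p.1 i :=
        fun i => (hSi i).comp measurable_fst
      have hV' : ∀ i j, Measurable fun p : Ω × (Fin d → ℝ) => V t p.1 i j :=
        fun i j => (hV i j).comp measurable_fst
      fun_prop
    exact hsum
  obtain ⟨hEm, hE⟩ := measure_exists_lt_lintegral_le (P := P)
    (ν := volume.restrict (unitBall d)) hXm (fun A hA hd => by
      filter_upwards [ae_restrict_mem (measurableSet_unitBall d)] with θ hθ
      obtain ⟨L, hL, hL0, hL1, hdom⟩ := h.exists_supermartingale hsg hl hθ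
      exact tsum_setLIntegral_le_one hL hL0 hL1 hdom hA hd)
    (volume (unitBall d) * ENNReal.ofReal (1 / δ))
  set E := {ω | ∃ t, volume (unitBall d) * ENNReal.ofReal (1 / δ)
    < ∫⁻ θ, X t ω θ ∂volume.restrict (unitBall d)} with hEdef
  have hEmeas : MeasurableSet E := by
    rw [hEdef, ofPred_exists]
    exact MeasurableSet.iUnion fun t => 𝓕.le t _ (hEm t)
  refine ⟨Eᶜ, hEmeas.compl, ?_, fun ω hω t => ?_⟩
  · have hPE : P E ≤ ENNReal.ofReal δ := by
      rw [Measure.restrict_apply_univ, mul_assoc] at hE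
      have h1 : ENNReal.ofReal (1 / δ) * P E ≤ 1 := by
        refine (ENNReal.mul_le_mul_iff_right (volume_unitBall_ne_zero d)
          (volume_unitBall_ne_top d)).1 ?_
        rwa [mul_one]
      calc P E = ENNReal.ofReal δ * (ENNReal.ofReal (1 / δ) * P E) := by
            rw [← mul_assoc, ← ENNReal.ofReal_mul hδ.le, mul_one_div_cancel hδ.ne',
              ENNReal.ofReal_one, one_mul]
        _ ≤ ENNReal.ofReal δ * 1 := by gcongr
        _ = _ := mul_one _
    rw [prob_compl_eq_one_sub hEmeas, ENNReal.ofReal_sub _ hδ.le, ENNReal.ofReal_one]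
    exact tsub_le_tsub_left hPE _
  · by_contra hcon
    exact hω ⟨t, not_le.1 hcon⟩

end SubPsi

/-! ### Combining the two bounds -/

/-- Serves to absorb the additive constants `2 * k` and `log 2` into the numerator of the final
bound. -/
theorem one_le_logLog (s : ℝ) : 1 ≤ logLog s := by
  have h1 : Real.exp 1 ≤ Real.log (max s (Real.exp (Real.exp 1))) := by
    rw [Real.le_log_iff_exp_le (lt_max_of_lt_right (Real.exp_pos _))]
    exact le_max_right _ _
  rw [logLog, Real.le_log_iff_exp_le ((Real.exp_pos 1).trans_le h1)]
  exact h1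

/-- A bound on the mixture over the unit ball bounds the self-normalized norm. -/
theorem matNorm_mul_le {d : ℕ} {V : Matrix (Fin d) (Fin d) ℝ} (hV : V.PosDef)
    (hg : 1 < gammaMin V) {S : Fin d → ℝ} {l k δ : ℝ} (hk : 0 ≤ k) (hδ : 0 < δ)
    (h : ∫⁻ θ in unitBall d,
          ENNReal.ofReal (Real.exp (l * (θ ⬝ᵥ S) - k * (θ ⬝ᵥ V.mulVec θ)))
        ≤ volume (unitBall d) * ENNReal.ofReal (1 / δ)) :
    l * matNorm V⁻¹ S * √(1 - 1 / gammaMin V) / 2 - 2 * k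
      ≤ Real.log 2 + Real.log V.det / 2 + Real.log (1 / δ) := by
  have h1 := (volume_mul_exp_le_lintegral_unitBall hV hg S hk).trans
    (mul_le_mul_right (mul_le_mul_right h _) _)
  set q := l * matNorm V⁻¹ S * √(1 - 1 / gammaMin V) / 2 - 2 * k
  have hdet : 0 < √V.det := Real.sqrt_pos.2 hV.det_pos
  have h2 : ENNReal.ofReal (Real.exp q) ≤ ENNReal.ofReal (2 * √V.det * (1 / δ)) := by
    refine (ENNReal.mul_le_mul_iff_right (volume_unitBall_ne_zero d)
      (volume_unitBall_ne_top d)).1 (h1.trans_eq ?_)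
    rw [ENNReal.ofReal_mul (by positivity), ENNReal.ofReal_mul (by norm_num),
      ENNReal.ofReal_ofNat]
    ring
  rw [ENNReal.ofReal_le_ofReal_iff (by positivity)] at h2
  have h3 := (Real.le_log_iff_exp_le (by positivity)).2 h2
  rwa [Real.log_mul (by positivity) (by positivity), Real.log_mul (by norm_num) hdet.ne',
    Real.log_sqrt hV.det_pos.le] at h3

end SelfNormalized

theorem theorem4 (ψ : ℝ → ℝ) (lmax : ℝ) (hlmax : 0 < lmax)
    (hψ : SelfNormalized.IsCGFLike ψ lmax)
    (hsg : SelfNormalized.IsSuperGaussian ψ lmax)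
    (hψ3 : SelfNormalized.HasNonnegThirdDeriv ψ lmax) :
    ∃ C : ℝ, 0 < C ∧
      ∀ (d : ℕ) (_ : 0 < d) (U₀ : Matrix (Fin d) (Fin d) ℝ) (_ : U₀.PosDef)
        (_ : (((SelfNormalized.gammaMin U₀)⁻¹ : ℝ) : EReal) < SelfNormalized.valueAtMax ψ lmax)
        (Ω : Type*) (m : MeasurableSpace Ω) (P : Measure Ω) (_ : IsProbabilityMeasure P)
        (𝓕 : Filtration ℕ m)
        (S : ℕ → Ω → Fin d → ℝ) (V : ℕ → Ω → Matrix (Fin d) (Fin d) ℝ)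
        (_ : SelfNormalized.IsSubPsi P 𝓕 ψ lmax S V)
        (_ : ∀ t, 1 ≤ t → ∀ᵐ ω ∂P, (V t ω - U₀).PosSemidef)
        (δ : ℝ) (_ : δ ∈ Ioo (0 : ℝ) 1),
        ∃ A : Set Ω, MeasurableSet A ∧ ENNReal.ofReal (1 - δ) ≤ P A ∧
          ∀ ω ∈ A, ∀ τ : Ω → WithTop ℕ, IsStoppingTime 𝓕 τ →
            ∀ t : ℕ, τ ω = t → 1 ≤ t → 1 < SelfNormalized.gammaMin (V t ω) →
              SelfNormalized.matNorm (V t ω)⁻¹ (S t ω) ≤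
                C * SelfNormalized.conjugateInv ψ lmax
                  ((Real.log (V t ω).det
                      + SelfNormalized.logLog (SelfNormalized.matNorm (V t ω)⁻¹ (S t ω))
                      + Real.log (1 / δ))
                    / √(1 - 1 / SelfNormalized.gammaMin (V t ω))) := by
  open SelfNormalized in
  -- Any fixed point of `(0, lmax)` would serve; the choice affects only `C`.
  set l := lmax / 2 with hl
  have hl0 : 0 < l := half_pos hlmax
  have hlI : l ∈ Ioo 0 lmax := ⟨hl0, half_lt_self hlmax⟩
  set k := ψ l with hk
  have hk0 : 0 ≤ k := hψ.nonneg l ⟨hl0.le, hlI.2⟩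
  -- The factor `2 * (2 * k + 1) / l` comes from solving `h1` for `N`, and `lmax` from the linear
  -- growth of `(ψ*)⁻¹`.
  refine ⟨2 * (2 * k + 1) / l * lmax, by positivity, ?_⟩
  intro d _ U₀ _ _ Ω m P _ 𝓕 S V hSV _ δ hδ
  obtain ⟨A, hAm, hPA, hA⟩ := hSV.exists_measurableSet_lintegral_le hsg hlI hδ.1
  -- Positive definiteness holds only almost surely, so a measurable null set is removed from the
  -- event.
  obtain ⟨B, hBsub, hBm, hPB⟩ := exists_measurable_superset_of_null
    (ae_iff.1 (ae_all_iff.2 hSV.posDef))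
  refine ⟨A \ B, hAm.diff hBm, by rwa [measure_sdiff_null hPB], ?_⟩
  rintro ω ⟨hωA, hωB⟩ τ - t - - hg
  have hV : (V t ω).PosDef := by
    by_contra hcon
    exact hωB (hBsub fun hall => hcon (hall t))
  have hmain := matNorm_mul_le hV hg hk0 hδ.1 (hA ω hωA t)
  set N := matNorm (V t ω)⁻¹ (S t ω) with hN
  set g := gammaMin (V t ω) with hgdef
  have hs : 0 < √(1 - 1 / g) := by
    refine Real.sqrt_pos.2 (sub_pos.2 ?_)
    rw [div_lt_one (one_pos.trans hg)]
    exact hg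
  set s := √(1 - 1 / g)
  have hD : 0 ≤ Real.log (V t ω).det :=
    Real.log_nonneg (one_le_det_of_one_le_gammaMin hV.isHermitian hg.le)
  have hll := one_le_logLog N
  have hδ' : 0 ≤ Real.log (1 / δ) :=
    Real.log_nonneg ((one_le_div hδ.1).2 hδ.2.le)
  set Y := Real.log (V t ω).det + logLog N + Real.log (1 / δ) with hY
  have hY1 : 1 ≤ Y := by linarith
  have hlog2 : Real.log 2 ≤ 1 := Real.log_two_lt_d9.le.trans (by norm_num)
  -- In `hmain`, `2 * k ≤ 2 * k * Y` since `Y ≥ 1`, `log 2` is at most `logLog N`, and half of `log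
  -- det V ≥ 0` is at most the whole.
  have h1 : l * N * s / 2 ≤ (2 * k + 1) * Y := by nlinarith
  calc N ≤ 2 * (2 * k + 1) / l * (Y / s) := by
        rw [div_mul_div_comm, le_div_iff₀ (by positivity)]
        linarith
    _ ≤ 2 * (2 * k + 1) / l * (lmax * conjugateInv ψ lmax (Y / s)) := by
        gcongr
        exact le_mul_conjugateInv hψ hlmax (by positivity)
    _ = _ := by ring
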